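/- Let $\mathsf X$ be a Polish space (for instance a separable Banach space) with its Borel $\sigma$-algebra and let $\mu_{\mathrm{pr}}$ be a probability measure on $\mathsf X$. For levels $1,\dots,\mathsf L$ let $\pi_0,\dots,\pi_{\mathsf L}$ (posterior densities) and $Q_1,\dots,Q_{\mathsf L}$ (proposal densities) be probability densities with respect to $\mu_{\mathrm{pr}}$. Assume: (1) all $Q_\ell$ and (2) all $\pi_j$ are continuous and strictly positive; (3) for $1\le\ell\le\mathsf L$, $j\in\{\ell-1,\ell\}$ and $r>0$ the set $\{Q_\ell/\pi_j\le r\}$ is compact; (4) there is $c\in(0,1)$, independent of $\ell$, with $\operatorname{ess\,inf}_{\mu_{\mathrm{pr}}} Q_\ell/\pi_j\ge c$ for $j\in\{\ell-1,\ell\}$; (5) there are $r>1$, $C_r>0$, independent of $\ell$, with $\int Q_\ell^r\,d\mu_{\mathrm{pr}}\le C_r$. For $1\le\ell\le\mathsf L$ and $j\in\{\ell-1,\ell\}$ put $\alpha_j(\theta,z)=\min\{1,\tfrac{Q_\ell(\theta)\pi_j(z)}{Q_\ell(z)\pi_j(\theta)}\}$. For $\boldsymbol\theta=(\theta_{\ell-1},\theta_\ell)\in\mathsf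 X^2$ abbreviate $a(z)=\alpha_{\ell-1}(\theta_{\ell-1},z)$, $b(z)=\alpha_\ell(\theta_\ell,z)$, $q(dz)=Q_\ell(z)\mu_{\mathrm{pr}}(dz)$, and let $$\boldsymbol p_\ell(\boldsymbol\theta,A)=\int \min\{a,b\}\mathbf 1_{(z,z)\in A}\,dq+\int (a-b)^+\mathbf 1_{(z,\theta_\ell)\in A}\,dq+\int (b-a)^+\mathbf 1_{(\theta_{\ell-1},z)\in A}\,dq+\mathbf 1_{\boldsymbol\theta\in A}\Big(1-\int\max\{a,b\}\,dq\Big)$$ be the (in general non-reversible) transition kernel of the coupled chain, with Markov operator $\boldsymbol P_\ell$. Let $\nu_\ell$ be the invariant probability measure of $\boldsymbol p_\ell$. For an operator $T$ on $L^2(\nu_\ell)$ preserving the mean-zero subspace $L^2_0(\nu_\ell)$ let $\gamma_2[T]=1-\|T\|_{L^2_0\to L^2_0}$, and let $$\gamma_{\mathrm{ps}}=\gamma_{\mathrm{ps}}[\boldsymbol P_\ell]=\max_{k\ge1}\gamma_2\big[(\boldsymbol P_\ell^*)^k\boldsymbol P_\ell^k\big]/k$$ be the pseudo-spectral gap, where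 $\boldsymbol P_\ell^*$ is the adjoint in $L^2(\nu_\ell)$. **Theorem (non-asymptotic bound on the mean square error).** Let $1\le\ell\le\mathsf L$, let $Y_\ell\in L^2(\mathsf X^2,\nu_\ell)$ be real-valued, let $\nu^0$ be a probability measure on $\mathsf X^2$ with $\nu^0\ll\nu_\ell$ and $\frac{d\nu^0}{d\nu_\ell}\in L^\infty(\nu_\ell)$, and let $(\boldsymbol\theta^n)_{n\ge0}$ be the Markov chain with kernel $\boldsymbol p_\ell$ and $\boldsymbol\theta^0\sim\nu^0$. Then $\gamma_{\mathrm{ps}}>0$, and for all integers $N_\ell\ge1$ and $n_b\ge0$ the squared error of the burn-in ergodic average is integrable and $$\mathsf E\left|\frac1{N_\ell}\sum_{n=1}^{N_\ell}Y_\ell(\boldsymbol\theta^{n+n_b})-\int Y_\ell\,d\nu_\ell\right|^2\le C_{\mathrm{mse},\ell}\,\frac{\mathbb V_{\nu_\ell}[Y_\ell]}{N_\ell},$$ where $C_{\mathrm{mse},\ell}=C_{\mathrm{inv},\ell}+C_{\mathrm{ns},\ell}$, $C_{\mathrm{inv},\ell}=1+\frac4{\gamma_{\mathrm{ps}}}$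 and $C_{\mathrm{ns},\ell}=2\left\|\frac{d\nu^0}{d\nu_\ell}-1\right\|_{L^\infty(\nu_\ell)}\left(1+\frac4{\gamma_{\mathrm{ps}}}\right)$. -/

import Mathlib

open MeasureTheory ProbabilityTheory Set
open scoped ENNReal NNReal

noncomputable section

/-! ### Markov operators on `L²(ν)` -/

section MarkovOperator

variable {S : Type*} [MeasurableSpace S]

theorem memLp_two_integral_kernel (p : Kernel S S) [IsMarkovKernel p] {ν : Measure S}
    (hν : p.Invariant ν) {f : S → ℝ} (hf : MemLp f 2 ν) :
    MemLp (fun x => ∫ y, f y ∂(p x)) 2 ν ∧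
      eLpNorm (fun x => ∫ y, f y ∂(p x)) 2 ν ≤ eLpNorm f 2 ν := by
  have hb : p ∘ₘ ν = ν := hν
  have hm : AEStronglyMeasurable f (p ∘ₘ ν) := by rw [hb]; exact hf.1
  have hsm : AEStronglyMeasurable (fun x => ∫ y, f y ∂(p x)) ν := by
    refine ⟨fun x => ∫ y, hm.mk f y ∂(p x), hm.stronglyMeasurable_mk.integral_kernel, ?_⟩
    filter_upwards [Measure.ae_ae_of_ae_comp hm.ae_eq_mk] with x hx
    exact integral_congr_ae hx
  have hle : eLpNorm (fun x => ∫ y, f y ∂(p x)) 2 ν ≤ eLpNorm f 2 ν := by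
    rw [eLpNorm_eq_lintegral_rpow_enorm_toReal (by norm_num) (by norm_num),
      eLpNorm_eq_lintegral_rpow_enorm_toReal (by norm_num) (by norm_num)]
    refine ENNReal.rpow_le_rpow ?_ (by norm_num)
    have h1 : ∫⁻ x, ‖f x‖ₑ ^ (2 : ℝ≥0∞).toReal ∂ν
        = ∫⁻ x, ∫⁻ y, ‖f y‖ₑ ^ (2 : ℝ≥0∞).toReal ∂(p x) ∂ν := by
      conv_lhs => rw [← hb]
      exact Measure.lintegral_bind p.measurable.aemeasurable (hm.enorm.pow_const _)
    rw [h1]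
    refine lintegral_mono_ae ?_
    filter_upwards [Measure.ae_ae_of_ae_comp hm.ae_eq_mk] with x hx
    have hfx : AEStronglyMeasurable f (p x) := ⟨_, hm.stronglyMeasurable_mk, hx⟩
    have h2 : ‖∫ y, f y ∂(p x)‖ₑ ≤ eLpNorm f 2 (p x) :=
      (enorm_integral_le_lintegral_enorm f).trans
        ((eLpNorm_one_eq_lintegral_enorm (f := f) (μ := p x)).symm.le.trans
          (eLpNorm_le_eLpNorm_of_exponent_le (by norm_num) hfx))
    calc ‖∫ y, f y ∂(p x)‖ₑ ^ (2 : ℝ≥0∞).toReal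
        ≤ (eLpNorm f 2 (p x)) ^ (2 : ℝ≥0∞).toReal := ENNReal.rpow_le_rpow h2 (by norm_num)
      _ = ∫⁻ y, ‖f y‖ₑ ^ (2 : ℝ≥0∞).toReal ∂(p x) := by
          rw [eLpNorm_eq_lintegral_rpow_enorm_toReal (by norm_num) (by norm_num),
            ← ENNReal.rpow_mul]
          norm_num
  exact ⟨⟨hsm, hle.trans_lt hf.2⟩, hle⟩

theorem ae_integrable_kernel (p : Kernel S S) [IsMarkovKernel p] {ν : Measure S}
    [IsProbabilityMeasure ν] (hν : p.Invariant ν) (f : Lp ℝ 2 ν) :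
    ∀ᵐ x ∂ν, Integrable f (p x) := by
  have hb : p ∘ₘ ν = ν := hν
  have h : Integrable f (p ∘ₘ ν) := by
    rw [hb]; exact (Lp.memLp f).integrable (by norm_num)
  exact Measure.ae_integrable_of_integrable_comp h

theorem ae_ae_kernel (p : Kernel S S) {ν : Measure S} (hν : p.Invariant ν)
    {q : S → Prop} (h : ∀ᵐ y ∂ν, q y) : ∀ᵐ x ∂ν, ∀ᵐ y ∂(p x), q y := by
  have hb : p ∘ₘ ν = ν := hν
  rw [← hb] at h
  exact Measure.ae_ae_of_ae_comp h

/-- The Markov operator `(P f)(x) = ∫ f(y) p(x, dy)` on `L²(ν)`, for a `ν`-invariant Markov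
kernel `p`. -/
def markovOperator (p : Kernel S S) [IsMarkovKernel p] (ν : Measure S) [IsProbabilityMeasure ν]
    (hν : p.Invariant ν) : Lp ℝ 2 ν →L[ℝ] Lp ℝ 2 ν :=
  LinearMap.mkContinuous
    { toFun := fun f => (memLp_two_integral_kernel p hν (Lp.memLp f)).1.toLp
        (fun x => ∫ y, f y ∂(p x))
      map_add' := by
        intro f g
        rw [← MemLp.toLp_add]
        refine MemLp.toLp_congr _ _ ?_
        filter_upwards [ae_integrable_kernel p hν f, ae_integrable_kernel p hν g,
          ae_ae_kernel p hν (Lp.coeFn_add f g)] with x hf hg hx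
        rw [integral_congr_ae hx]
        exact integral_add hf hg
      map_smul' := by
        intro c f
        rw [RingHom.id_apply, ← MemLp.toLp_const_smul]
        refine MemLp.toLp_congr _ _ ?_
        filter_upwards [ae_ae_kernel p hν (Lp.coeFn_smul c f)] with x hx
        rw [integral_congr_ae hx]
        exact integral_const_mul c _ }
    1 (by
      intro f
      rw [one_mul, LinearMap.coe_mk, AddHom.coe_mk, Lp.norm_toLp, Lp.norm_def]
      exact ENNReal.toReal_mono (Lp.memLp f).eLpNorm_ne_top
        (memLp_two_integral_kernel p hν (Lp.memLp f)).2)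

theorem coeFn_markovOperator (p : Kernel S S) [IsMarkovKernel p] (ν : Measure S)
    [IsProbabilityMeasure ν] (hν : p.Invariant ν) (f : Lp ℝ 2 ν) :
    markovOperator p ν hν f =ᵐ[ν] fun x => ∫ y, f y ∂(p x) :=
  MemLp.coeFn_toLp (memLp_two_integral_kernel p hν (Lp.memLp f)).1

/-- The subspace `L²₀(ν)` of functions in `L²(ν)` with `ν`-mean zero. -/
def meanZero (ν : Measure S) [IsProbabilityMeasure ν] : Submodule ℝ (Lp ℝ 2 ν) where
  carrier := {f | ∫ x, f x ∂ν = 0}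
  add_mem' := by
    intro f g hf hg
    simp only [mem_ofPred_eq] at hf hg ⊢
    rw [integral_congr_ae (Lp.coeFn_add f g)]
    have := integral_add ((Lp.memLp f).integrable (by norm_num))
      ((Lp.memLp g).integrable (by norm_num))
    simp only [Pi.add_apply]
    rw [this, hf, hg, add_zero]
  zero_mem' := by
    simp only [mem_ofPred_eq]
    rw [integral_congr_ae (Lp.coeFn_zero ℝ 2 ν)]
    simp
  smul_mem' := by
    intro c f hf
    simp only [mem_ofPred_eq] at hf ⊢
    rw [integral_congr_ae (Lp.coeFn_smul c f)]
    simp only [Pi.smul_apply, smul_eq_mul]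
    rw [integral_const_mul, hf, mul_zero]

/-- The `L²`-spectral gap `γ₂[T] = 1 - ‖T‖_{L²₀ → L²₀}`. It is used for operators `T` that map
`L²₀(ν)` into itself; the norm of `T` as an operator `L²₀ → L²₀` is the norm of its restriction
to `L²₀`. -/
def spectralGap {ν : Measure S} [IsProbabilityMeasure ν] (T : Lp ℝ 2 ν →L[ℝ] Lp ℝ 2 ν) : ℝ :=
  1 - ‖T.comp (meanZero ν).subtypeL‖

/-- The pseudo-spectral gap `γ_ps[P] = max_{k ≥ 1} γ₂[(P*)ᵏ Pᵏ] / k`, where `P*` is the adjoint of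
`P` in `L²(ν)`. (The set of values is bounded above by `1`; as `0 ≤ γ₂[(P*)ᵏ Pᵏ] ≤ 1` for Markov
operators, the supremum is a maximum.) -/
def pseudoSpectralGap (p : Kernel S S) [IsMarkovKernel p] (ν : Measure S) [IsProbabilityMeasure ν]
    (hν : p.Invariant ν) : ℝ :=
  ⨆ k : ℕ+, spectralGap
    (ContinuousLinearMap.adjoint (markovOperator p ν hν) ^ (k : ℕ)
      * markovOperator p ν hν ^ (k : ℕ)) / (k : ℝ)

/-! ### The chain and its ergodic estimator -/

/-- The law on trajectories `(θ⁰, θ¹, …)` of the Markov chain with `θ⁰ ∼ ν⁰` and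
`θⁿ⁺¹ ∼ p(θⁿ, ·)`. -/
def chainLaw (p : Kernel S S) [IsMarkovKernel p] (ν₀ : Measure S) : Measure (ℕ → S) :=
  Kernel.trajMeasure (X := fun _ => S) ν₀
    (fun n => p.comap (fun x : (i : Finset.Iic n) → S => x ⟨n, Finset.mem_Iic.2 le_rfl⟩)
      (measurable_pi_apply _))

/-- The ergodic estimator `(1/N) ∑_{n=1}^N Y(θ^{n + n_b})` with burn-in `n_b`. -/
def ergodicEstimator (Y : S → ℝ) (N nb : ℕ) (θ : ℕ → S) : ℝ :=
  1 / (N : ℝ) * ∑ n ∈ Finset.Icc 1 N, Y (θ (n + nb))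

/-- The squared error of the ergodic estimator along a trajectory. -/
def squaredError (ν : Measure S) (Y : S → ℝ) (N nb : ℕ) (θ : ℕ → S) : ℝ :=
  (ergodicEstimator Y N nb θ - ∫ x, Y x ∂ν) ^ 2

/-- The mean square error of the ergodic estimator for the chain started from `ν₀`. -/
def meanSquareError (p : Kernel S S) [IsMarkovKernel p] (ν₀ ν : Measure S) (Y : S → ℝ)
    (N nb : ℕ) : ℝ :=
  ∫ θ, squaredError ν Y N nb θ ∂(chainLaw p ν₀)

/-- `dν⁰/dν`, as a real-valued function. -/
def initialDensity (ν₀ ν : Measure S) (x : S) : ℝ := (ν₀.rnDeriv ν x).toReal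

/-- `‖dν⁰/dν - 1‖_{L^∞(ν)}`. -/
def initialDiscrepancy (ν₀ ν : Measure S) : ℝ :=
  (eLpNorm (fun x => initialDensity ν₀ ν x - 1) ∞ ν).toReal

/-- `C_inv = 1 + 4 / γ_ps`. -/
def constInv (p : Kernel S S) [IsMarkovKernel p] (ν : Measure S) [IsProbabilityMeasure ν]
    (hν : p.Invariant ν) : ℝ :=
  1 + 4 / pseudoSpectralGap p ν hν

/-- `C_ns = 2 ‖dν⁰/dν - 1‖_{L^∞(ν)} (1 + 4 / γ_ps)`. -/
def constNs (p : Kernel S S) [IsMarkovKernel p] (ν₀ ν : Measure S) [IsProbabilityMeasure ν]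
    (hν : p.Invariant ν) : ℝ :=
  2 * initialDiscrepancy ν₀ ν * (1 + 4 / pseudoSpectralGap p ν hν)

/-- `C_mse = C_inv + C_ns`. -/
def constMse (p : Kernel S S) [IsMarkovKernel p] (ν₀ ν : Measure S) [IsProbabilityMeasure ν]
    (hν : p.Invariant ν) : ℝ :=
  constInv p ν hν + constNs p ν₀ ν hν

end MarkovOperator

/-! ### The multi-level independent Metropolis-Hastings chain -/

/-- The data of the multi-level method: a prior probability measure, posterior densities
`π_0, …, π_L` and proposal densities `Q_1, …, Q_L`, all with respect to the prior. The level
`ℓ ∈ {1, …, L}` is represented by `i : Fin L` with `ℓ = i + 1`, so that `post i.succ` is `π_ℓ`,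
`post i.castSucc` is `π_{ℓ-1}` and `prop i` is `Q_ℓ`. -/
structure MultilevelModel (X : Type*) [MeasurableSpace X] where
  L : ℕ
  prior : Measure X
  post : Fin (L + 1) → X → ℝ
  prop : Fin L → X → ℝ
  prior_prob : IsProbabilityMeasure prior
  post_measurable : ∀ j, Measurable (post j)
  post_nonneg : ∀ j z, 0 ≤ post j z
  post_lintegral : ∀ j, ∫⁻ z, ENNReal.ofReal (post j z) ∂prior = 1
  prop_measurable : ∀ i, Measurable (prop i)
  prop_nonneg : ∀ i z, 0 ≤ prop i z
  prop_lintegral : ∀ i, ∫⁻ z, ENNReal.ofReal (prop i z) ∂prior = 1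

attribute [instance] MultilevelModel.prior_prob

/-- The acceptance probability `α(θ, z) = min{1, Q(θ) π(z) / (Q(z) π(θ))}` of the independent
Metropolis-Hastings algorithm with target density `π` and proposal density `Q`. -/
def acceptProb {X : Type*} (π Q : X → ℝ) (θ z : X) : ℝ :=
  min 1 (Q θ * π z / (Q z * π θ))

theorem acceptProb_nonneg {X : Type*} {π Q : X → ℝ} (hπ : ∀ z, 0 ≤ π z) (hQ : ∀ z, 0 ≤ Q z)
    (θ z : X) : 0 ≤ acceptProb π Q θ z :=
  le_min zero_le_one (div_nonneg (mul_nonneg (hQ _) (hπ _)) (mul_nonneg (hQ _) (hπ _)))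

theorem acceptProb_le_one {X : Type*} (π Q : X → ℝ) (θ z : X) : acceptProb π Q θ z ≤ 1 :=
  min_le_left _ _

theorem measurable_map_withDensity {X S T : Type*} [MeasurableSpace X] [MeasurableSpace S]
    [MeasurableSpace T] (μ : Measure X) [SFinite μ] {f : S → X → ℝ≥0∞} {g : S → X → T}
    (hf : Measurable (Function.uncurry f)) (hg : Measurable (Function.uncurry g)) :
    Measurable fun s => (μ.withDensity (f s)).map (g s) := by
  refine Measure.measurable_of_measurable_coe _ fun A hA => ?_
  have hgs : ∀ s, Measurable (g s) := fun s => hg.comp measurable_prodMk_left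
  have : (fun s => (μ.withDensity (f s)).map (g s) A)
      = fun s => ∫⁻ z, (Function.uncurry g ⁻¹' A).indicator (Function.uncurry f) (s, z) ∂μ := by
    funext s
    rw [Measure.map_apply (hgs s) hA, withDensity_apply _ (hgs s hA),
      ← lintegral_indicator (hgs s hA)]
    rfl
  rw [this]
  exact (hf.indicator (hg hA)).lintegral_prod_right'

namespace MultilevelModel

variable {X : Type*} [MeasurableSpace X] (M : MultilevelModel X)

/-- `α_{ℓ-1}(θ_{ℓ,ℓ-1}, z)`, for the pair `θ = (θ_{ℓ,ℓ-1}, θ_{ℓ,ℓ})`. -/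
def acceptCoarse (i : Fin M.L) (θ : X × X) (z : X) : ℝ :=
  acceptProb (M.post i.castSucc) (M.prop i) θ.1 z

/-- `α_ℓ(θ_{ℓ,ℓ}, z)`, for the pair `θ = (θ_{ℓ,ℓ-1}, θ_{ℓ,ℓ})`. -/
def acceptFine (i : Fin M.L) (θ : X × X) (z : X) : ℝ :=
  acceptProb (M.post i.succ) (M.prop i) θ.2 z

theorem measurable_acceptCoarse (i : Fin M.L) :
    Measurable (Function.uncurry (M.acceptCoarse i)) := by
  have h1 := M.post_measurable i.castSucc
  have h2 := M.prop_measurable i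
  unfold Function.uncurry acceptCoarse acceptProb
  fun_prop

theorem measurable_acceptFine (i : Fin M.L) :
    Measurable (Function.uncurry (M.acceptFine i)) := by
  have h1 := M.post_measurable i.succ
  have h2 := M.prop_measurable i
  unfold Function.uncurry acceptFine acceptProb
  fun_prop

/-- The probability that at least one component moves,
`∫ max{α_{ℓ-1}(θ_{ℓ,ℓ-1}, z), α_ℓ(θ_{ℓ,ℓ}, z)} Q_ℓ(z) μ_pr(dz)`. -/
def moveProb (i : Fin M.L) (θ : X × X) : ℝ≥0∞ :=
  ∫⁻ z, ENNReal.ofReal (max (M.acceptCoarse i θ z) (M.acceptFine i θ z) * M.prop i z) ∂M.prior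

/-- The joint transition kernel of the two coupled independent Metropolis-Hastings chains at level
`ℓ`, which use the same proposal `z ∼ Q_ℓ μ_pr` and the same uniform variable in the
accept-reject step: both components move to `z`, or only the coarse one does, or only
the fine one does, or neither. -/
def jointKernel (i : Fin M.L) : Kernel (X × X) (X × X) where
  toFun θ :=
    (M.prior.withDensity fun z => ENNReal.ofReal
        (min (M.acceptCoarse i θ z) (M.acceptFine i θ z) * M.prop i z)).map (fun z => (z, z))
    + (M.prior.withDensity fun z => ENNReal.ofReal
        (max (M.acceptCoarse i θ z - M.acceptFine i θ z) 0 * M.prop i z)).map (fun z => (z, θ.2))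
    + (M.prior.withDensity fun z => ENNReal.ofReal
        (max (M.acceptFine i θ z - M.acceptCoarse i θ z) 0 * M.prop i z)).map (fun z => (θ.1, z))
    + (1 - M.moveProb i θ) • Measure.dirac θ
  measurable' := by
    have h0 := M.prop_measurable i
    have h1 : Measurable fun q : (X × X) × X => M.acceptCoarse i q.1 q.2 :=
      M.measurable_acceptCoarse i
    have h2 : Measurable fun q : (X × X) × X => M.acceptFine i q.1 q.2 :=
      M.measurable_acceptFine i
    have h3 : Measurable fun q : (X × X) × X => M.prop i q.2 := h0.comp measurable_snd
    have hm : Measurable (M.moveProb i) := by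
      unfold moveProb
      exact Measurable.lintegral_prod_right'
        (f := fun q : (X × X) × X => ENNReal.ofReal
          (max (M.acceptCoarse i q.1 q.2) (M.acceptFine i q.1 q.2) * M.prop i q.2))
        ((h1.max h2).mul h3).ennreal_ofReal
    have hadd : ∀ {m n : X × X → Measure (X × X)}, Measurable m → Measurable n →
        Measurable fun θ => m θ + n θ := fun hm' hn' =>
      Measure.measurable_of_measurable_coe _ fun A hA => by
        simp only [Measure.add_apply]
        exact ((Measure.measurable_coe hA).comp hm').add ((Measure.measurable_coe hA).comp hn')
    refine hadd (hadd (hadd ?_ ?_) ?_) ?_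
    · exact measurable_map_withDensity M.prior
        (f := fun θ z => ENNReal.ofReal
          (min (M.acceptCoarse i θ z) (M.acceptFine i θ z) * M.prop i z))
        (g := fun (_ : X × X) z => (z, z))
        ((h1.min h2).mul h3).ennreal_ofReal (measurable_snd.prodMk measurable_snd)
    · exact measurable_map_withDensity M.prior
        (f := fun θ z => ENNReal.ofReal
          (max (M.acceptCoarse i θ z - M.acceptFine i θ z) 0 * M.prop i z))
        (g := fun (θ : X × X) z => (z, θ.2))
        (((h1.sub h2).max measurable_const).mul h3).ennreal_ofReal
        (measurable_snd.prodMk (measurable_snd.comp measurable_fst))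
    · exact measurable_map_withDensity M.prior
        (f := fun θ z => ENNReal.ofReal
          (max (M.acceptFine i θ z - M.acceptCoarse i θ z) 0 * M.prop i z))
        (g := fun (θ : X × X) z => (θ.1, z))
        (((h2.sub h1).max measurable_const).mul h3).ennreal_ofReal
        ((measurable_fst.comp measurable_fst).prodMk measurable_snd)
    · refine Measure.measurable_of_measurable_coe _ fun A hA => ?_
      simp only [Measure.smul_apply, smul_eq_mul]
      exact (measurable_const.sub hm).mul (Measure.measurable_coe hA |>.comp Measure.measurable_dirac)

instance (i : Fin M.L) : IsMarkovKernel (M.jointKernel i) where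
  isProbabilityMeasure θ := by
    constructor
    have h1 : Measurable fun z => M.acceptCoarse i θ z :=
      (M.measurable_acceptCoarse i).comp measurable_prodMk_left
    have h2 : Measurable fun z => M.acceptFine i θ z :=
      (M.measurable_acceptFine i).comp measurable_prodMk_left
    have h3 := M.prop_measurable i
    have hQ := M.prop_nonneg i
    have a0 : ∀ z, 0 ≤ M.acceptCoarse i θ z := fun z =>
      acceptProb_nonneg (M.post_nonneg _) hQ _ _
    have b0 : ∀ z, 0 ≤ M.acceptFine i θ z := fun z =>
      acceptProb_nonneg (M.post_nonneg _) hQ _ _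
    have a1 : ∀ z, M.acceptCoarse i θ z ≤ 1 := fun z => acceptProb_le_one _ _ _ _
    have b1 : ∀ z, M.acceptFine i θ z ≤ 1 := fun z => acceptProb_le_one _ _ _ _
    have hle : M.moveProb i θ ≤ 1 := by
      rw [← M.prop_lintegral i]
      refine lintegral_mono fun z => ENNReal.ofReal_le_ofReal ?_
      exact mul_le_of_le_one_left (hQ z) (max_le (a1 z) (b1 z))
    simp only [jointKernel, Kernel.coe_mk, Measure.add_apply, Measure.smul_apply]
    rw [Measure.map_apply (by fun_prop) .univ, Measure.map_apply (by fun_prop) .univ,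
      Measure.map_apply (by fun_prop) .univ]
    simp only [preimage_univ, withDensity_apply _ MeasurableSet.univ, Measure.restrict_univ,
      measure_univ, smul_eq_mul, mul_one]
    rw [← lintegral_add_left (by fun_prop), ← lintegral_add_left (by fun_prop)]
    have : ∀ z, ENNReal.ofReal (min (M.acceptCoarse i θ z) (M.acceptFine i θ z) * M.prop i z)
        + ENNReal.ofReal (max (M.acceptCoarse i θ z - M.acceptFine i θ z) 0 * M.prop i z)
        + ENNReal.ofReal (max (M.acceptFine i θ z - M.acceptCoarse i θ z) 0 * M.prop i z)
        = ENNReal.ofReal (max (M.acceptCoarse i θ z) (M.acceptFine i θ z) * M.prop i z) := by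
      intro z
      rw [← ENNReal.ofReal_add (mul_nonneg (le_min (a0 z) (b0 z)) (hQ z))
          (mul_nonneg (le_max_right _ _) (hQ z)),
        ← ENNReal.ofReal_add (add_nonneg (mul_nonneg (le_min (a0 z) (b0 z)) (hQ z))
          (mul_nonneg (le_max_right _ _) (hQ z))) (mul_nonneg (le_max_right _ _) (hQ z)),
        ← add_mul, ← add_mul]
      congr 2
      rcases le_total (M.acceptCoarse i θ z) (M.acceptFine i θ z) with h | h
      · rw [min_eq_left h, max_eq_right h, max_eq_right (sub_nonpos.2 h),
          max_eq_left (sub_nonneg.2 h)]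
        ring
      · rw [min_eq_right h, max_eq_left h, max_eq_right (sub_nonpos.2 h),
          max_eq_left (sub_nonneg.2 h)]
        ring
    simp only [this]
    exact add_tsub_cancel_of_le hle

/-- The standing assumptions on the proposal and posterior densities. -/
structure Assumptions [TopologicalSpace X] : Prop where
  prop_continuous : ∀ i, Continuous (M.prop i)
  prop_pos : ∀ i z, 0 < M.prop i z
  post_continuous : ∀ j, Continuous (M.post j)
  post_pos : ∀ j z, 0 < M.post j z
  compact_coarse : ∀ i, ∀ r : ℝ, 0 < r →
    IsCompact {θ | M.prop i θ / M.post i.castSucc θ ≤ r}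
  compact_fine : ∀ i, ∀ r : ℝ, 0 < r →
    IsCompact {θ | M.prop i θ / M.post i.succ θ ≤ r}
  ess_inf : ∃ c : ℝ, 0 < c ∧ c < 1 ∧ ∀ i,
    (∀ᵐ z ∂M.prior, c ≤ M.prop i z / M.post i.castSucc z) ∧
    (∀ᵐ z ∂M.prior, c ≤ M.prop i z / M.post i.succ z)
  moments : ∃ r C : ℝ, 1 < r ∧ 0 < C ∧ ∀ i,
    ∫⁻ z, ENNReal.ofReal (M.prop i z ^ r) ∂M.prior ≤ ENNReal.ofReal C

end MultilevelModel

end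

/-!
The proof rests on a Doeblin minorization `p(x, ·) ≥ m` with `m ≠ 0`. It makes the Markov operator
`P` satisfy `‖P f‖² ≤ (1 - m(S)) ‖f‖²` on `L²₀(ν)`, whence `γ_ps ≥ m(S) > 0`. For the coupled
Metropolis-Hastings chain, `Q_ℓ / π_j` is continuous, positive and has compact sublevel sets, so it
attains its minimum and is bounded below by some `c_j > 0` everywhere; then
`α_j(θ, z) Q_ℓ(z) ≥ c_j π_j(z)` for all `θ`, and the moves of both components to a common `z`
provide `m`.

Let `r_k` be the norm of `Pᵏ` on `L²₀(ν)`, so that `γ₂[(P*)ᵏ Pᵏ] = 1 - r_k²`. Along the stationary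
chain, the autocovariance of `f ∈ L²₀(ν)` at lag `m` is `⟪f, Pᵐ f⟫ ≤ r_k ^ ⌊m / k⌋ ‖f‖²`. Summing
over lags in blocks of length `k` gives a geometric series, and the second moment of a sum of `N`
consecutive terms is at most `4 N ‖f‖² / γ_ps`. Starting from `ν⁰` instead of `ν` costs at most the
factor `1 + ‖dν⁰/dν - 1‖_∞`, because it bounds the density of `ν⁰` and hence the density of the law
of the whole trajectory.
-/

section RestrictedNorm

theorem norm_pow_apply_le_pow_div {𝕜 E : Type*} [NontriviallyNormedField 𝕜]
    [SeminormedAddCommGroup E] [NormedSpace 𝕜 E] {T : E →L[𝕜] E} (hT : ‖T‖ ≤ 1)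
    {V : Submodule 𝕜 E} (hV : MapsTo T V V) (k m : ℕ) {f : E} (hf : f ∈ V) :
    ‖(T ^ m) f‖ ≤ ‖(T ^ k).comp V.subtypeL‖ ^ (m / k) * ‖f‖ := by
  have norm_pow_apply_le (n : ℕ) (g : E) : ‖(T ^ n) g‖ ≤ ‖g‖ := by
    induction n with
    | zero => simp
    | succ n ih =>
      rw [pow_succ', mul_apply_eq_comp]
      exact (T.le_of_opNorm_le hT _).trans (by rwa [one_mul])
  have pow_mul_mem (q : ℕ) : (T ^ (k * q)) f ∈ V := by
    rw [FunLike.coe_pow_eq_iterate]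
    exact hV.iterate (k * q) hf
  have block (q : ℕ) : ‖(T ^ (k * q)) f‖ ≤ ‖(T ^ k).comp V.subtypeL‖ ^ q * ‖f‖ := by
    induction q with
    | zero => simp
    | succ q ih =>
      calc ‖(T ^ (k * (q + 1))) f‖ = ‖(T ^ k) ((T ^ (k * q)) f)‖ := by
            rw [← mul_apply_eq_comp, ← pow_add, mul_add_one, add_comm]
        _ ≤ ‖(T ^ k).comp V.subtypeL‖ * ‖(T ^ (k * q)) f‖ :=
            ((T ^ k).comp V.subtypeL).le_opNorm ⟨_, pow_mul_mem q⟩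
        _ ≤ ‖(T ^ k).comp V.subtypeL‖ ^ (q + 1) * ‖f‖ := by
            rw [pow_succ', mul_assoc]
            gcongr
  calc ‖(T ^ m) f‖ = ‖(T ^ (m % k)) ((T ^ (k * (m / k))) f)‖ := by
        rw [← mul_apply_eq_comp, ← pow_add, Nat.mod_add_div]
    _ ≤ ‖(T ^ (k * (m / k))) f‖ := norm_pow_apply_le _ _
    _ ≤ ‖(T ^ k).comp V.subtypeL‖ ^ (m / k) * ‖f‖ := block _

open ContinuousLinearMap in
theorem norm_adjoint_mul_self_comp_subtypeL {𝕜 E : Type*} [RCLike 𝕜] [NormedAddCommGroup E]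
    [InnerProductSpace 𝕜 E] [CompleteSpace E] (T : E →L[𝕜] E) {V : Submodule 𝕜 E}
    (hV : MapsTo (adjoint T * T) V V) :
    ‖(adjoint T * T).comp V.subtypeL‖ = ‖T.comp V.subtypeL‖ ^ 2 := by
  have norm_apply_le {g : E} (hg : g ∈ V) : ‖T g‖ ≤ ‖T.comp V.subtypeL‖ * ‖g‖ :=
    (T.comp V.subtypeL).le_opNorm ⟨g, hg⟩
  refine le_antisymm (opNorm_le_bound _ (by positivity) fun ⟨f, hf⟩ => ?_) ?_
  · set u := adjoint T (T f)
    change ‖u‖ ≤ ‖T.comp V.subtypeL‖ ^ 2 * ‖f‖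
    have hu : u ∈ V := hV hf
    have hsq : ‖u‖ * ‖u‖ ≤ ‖T.comp V.subtypeL‖ ^ 2 * ‖f‖ * ‖u‖ := calc
      ‖u‖ * ‖u‖ = RCLike.re (inner 𝕜 (T f) (T u)) := by
        rw [← adjoint_inner_left, inner_self_eq_norm_mul_norm]
      _ ≤ ‖T f‖ * ‖T u‖ := re_inner_le_norm _ _
      _ ≤ (‖T.comp V.subtypeL‖ * ‖f‖) * (‖T.comp V.subtypeL‖ * ‖u‖) :=
        mul_le_mul (norm_apply_le hf) (norm_apply_le hu) (norm_nonneg _) (by positivity)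
      _ = ‖T.comp V.subtypeL‖ ^ 2 * ‖f‖ * ‖u‖ := by ring
    rcases (norm_nonneg u).eq_or_lt with hu0 | hu0
    · rw [← hu0]
      positivity
    · exact le_of_mul_le_mul_right hsq hu0
  · refine (Real.le_sqrt (norm_nonneg _) (norm_nonneg _)).1
      (opNorm_le_bound _ (Real.sqrt_nonneg _) fun ⟨f, hf⟩ => ?_)
    change ‖T f‖ ≤ _ * ‖f‖
    refine abs_le_of_sq_le_sq' ?_ (by positivity) |>.2
    calc ‖T f‖ ^ 2 = RCLike.re (inner 𝕜 ((adjoint T * T) f) f) :=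
          apply_norm_sq_eq_inner_adjoint_left T f
      _ ≤ ‖(adjoint T * T) f‖ * ‖f‖ := re_inner_le_norm _ _
      _ ≤ ‖(adjoint T * T).comp V.subtypeL‖ * ‖f‖ * ‖f‖ := by
          gcongr
          exact ((adjoint T * T).comp V.subtypeL).le_opNorm ⟨f, hf⟩
      _ = (√‖(adjoint T * T).comp V.subtypeL‖ * ‖f‖) ^ 2 := by
          rw [mul_pow, Real.sq_sqrt (norm_nonneg _)]
          ring

end RestrictedNorm

section DecaySums

theorem sum_range_mul_comp_div {R : Type*} [AddCommMonoid R] {k : ℕ} (hk : 0 < k) (c : ℕ → R)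
    (n : ℕ) :
    ∑ m ∈ Finset.range (k * n), c (m / k) = k • ∑ q ∈ Finset.range n, c q := by
  induction n with
  | zero => simp
  | succ n ih =>
    have last_block : ∑ m ∈ Finset.range k, c ((k * n + m) / k) = k • c n := by
      simpa using Finset.sum_eq_card_nsmul (s := Finset.range k) fun j hj => congrArg c <| by
        rw [Nat.mul_add_div hk, Nat.div_eq_of_lt (Finset.mem_range.1 hj), add_zero]
    rw [mul_add_one, Finset.sum_range_add, ih, Finset.sum_range_succ, smul_add, last_block]

theorem one_sub_sq_div_mul_sum_pow_div_le_two {k : ℕ} (hk : 0 < k) {r : ℝ} (hr0 : 0 ≤ r)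
    (hr1 : r ≤ 1) (N : ℕ) :
    (1 - r ^ 2) / k * ∑ m ∈ Finset.range N, r ^ (m / k) ≤ 2 := by
  have sum_le : ∑ m ∈ Finset.range N, r ^ (m / k) ≤ k * ∑ q ∈ Finset.range N, r ^ q := by
    rw [← nsmul_eq_mul, ← sum_range_mul_comp_div hk]
    exact Finset.sum_le_sum_of_subset_of_nonneg
      (Finset.range_subset_range.2 (Nat.le_mul_of_pos_left _ hk)) fun _ _ _ => by positivity
  have one_sub_sq_nonneg : 0 ≤ 1 - r ^ 2 := sub_nonneg.2 (pow_le_one₀ hr0 hr1)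
  calc (1 - r ^ 2) / k * ∑ m ∈ Finset.range N, r ^ (m / k)
      ≤ (1 - r ^ 2) / k * (k * ∑ q ∈ Finset.range N, r ^ q) := by gcongr
    _ = (1 + r) * ((1 - r) * ∑ q ∈ Finset.range N, r ^ q) := by field_simp; ring
    _ = (1 + r) * (1 - r ^ N) := by rw [mul_neg_geom_sum]
    _ ≤ 2 := by nlinarith [pow_nonneg hr0 N, pow_le_one₀ hr0 hr1 (n := N)]

theorem sum_Icc_comp_dist_le {R : Type*} [AddCommMonoid R] [PartialOrder R]
    [IsOrderedAddMonoid R] {c : ℕ → R} (hc : ∀ m, 0 ≤ c m) {N i : ℕ}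
    (hi : i ∈ Finset.Icc 1 N) :
    ∑ j ∈ Finset.Icc 1 N, c (Nat.dist i j) ≤ 2 • ∑ m ∈ Finset.range N, c m := by
  rw [Finset.mem_Icc] at hi
  have one_sided {s : Finset ℕ} (hs : s ⊆ Finset.Icc 1 N) (hinj : InjOn (Nat.dist i) s) :
      ∑ j ∈ s, c (Nat.dist i j) ≤ ∑ m ∈ Finset.range N, c m := by
    rw [← Finset.sum_image hinj]
    refine Finset.sum_le_sum_of_subset_of_nonneg (Finset.image_subset_iff.2 fun j hj => ?_)
      fun m _ _ => hc m
    have := Finset.mem_Icc.1 (hs hj)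
    rw [Finset.mem_range, Nat.dist]
    omega
  rw [two_nsmul, ← Finset.sum_filter_add_sum_filter_not (Finset.Icc 1 N) (· ≤ i)]
  refine add_le_add (one_sided (Finset.filter_subset _ _) fun a ha b hb hab => ?_)
    (one_sided (Finset.filter_subset _ _) fun a ha b hb hab => ?_) <;>
  · simp only [Finset.coe_filter, mem_ofPred_eq, Nat.dist] at ha hb hab
    omega

end DecaySums

/-! ### Contraction of Markov operators on `L²₀(ν)` -/

section MarkovOperatorLemmas

variable {S : Type*} [MeasurableSpace S] {ν : Measure S}

section Invariant

variable {E : Type*} [NormedAddCommGroup E] [NormedSpace ℝ E] {p : Kernel S S} {f : S → E}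

theorem comp_const_apply_of_invariant (hν : p.Invariant ν) :
    (p ∘ₖ Kernel.const Unit ν) () = ν := by
  rw [← Measure.comp_eq_comp_const_apply, hν.def]

theorem integrable_integral_of_invariant (hν : p.Invariant ν) (hf : Integrable f ν) :
    Integrable (fun x => ∫ y, f y ∂(p x)) ν := by
  rw [← comp_const_apply_of_invariant hν] at hf
  exact hf.integral_comp

theorem integral_integral_of_invariant [IsSFiniteKernel p] [SFinite ν] (hν : p.Invariant ν)
    (hf : Integrable f ν) : ∫ x, ∫ y, f y ∂(p x) ∂ν = ∫ x, f x ∂ν := by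
  rw [← comp_const_apply_of_invariant hν] at hf
  rw [← Kernel.const_apply ν (), ← Kernel.integral_comp hf, Kernel.const_apply,
    comp_const_apply_of_invariant hν]

end Invariant

theorem inner_const_one [IsFiniteMeasure ν] (f : Lp ℝ 2 ν) :
    inner ℝ (Lp.const 2 ν (1 : ℝ)) f = ∫ x, f x ∂ν := by
  rw [L2.inner_def]
  refine integral_congr_ae ?_
  filter_upwards [Lp.coeFn_const 2 ν (1 : ℝ)] with x hx
  rw [hx]
  simp

theorem norm_sq_eq_integral_sq (f : Lp ℝ 2 ν) : ‖f‖ ^ 2 = ∫ x, f x ^ 2 ∂ν := by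
  rw [← real_inner_self_eq_norm_sq, L2.inner_def]
  simp [sq]

theorem sq_integral_le_measureReal_mul [IsFiniteMeasure ν] {f : S → ℝ} (hf : MemLp f 2 ν) :
    (∫ x, f x ∂ν) ^ 2 ≤ ν.real univ * ∫ x, f x ^ 2 ∂ν := by
  have integral_eq : ∫ x, f x ∂ν = inner ℝ (Lp.const 2 ν (1 : ℝ)) hf.toLp := by
    rw [inner_const_one, integral_congr_ae hf.coeFn_toLp]
  have integral_sq_eq : ∫ x, f x ^ 2 ∂ν = inner ℝ hf.toLp hf.toLp := by
    rw [real_inner_self_eq_norm_sq, norm_sq_eq_integral_sq]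
    refine integral_congr_ae ?_
    filter_upwards [hf.coeFn_toLp] with x hx
    rw [hx]
  have measureReal_eq :
      ν.real univ = inner ℝ (Lp.const 2 ν (1 : ℝ)) (Lp.const 2 ν (1 : ℝ)) := by
    rw [inner_const_one, integral_congr_ae (Lp.coeFn_const 2 ν (1 : ℝ))]
    simp
  rw [integral_eq, integral_sq_eq, measureReal_eq, sq]
  exact real_inner_mul_inner_self_le _ _

theorem sq_integral_sub_integral_le_of_le {m q : Measure S} [IsFiniteMeasure q] (hmq : m ≤ q)
    {f : S → ℝ} (hf : MemLp f 2 q) :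
    (∫ x, f x ∂q - ∫ x, f x ∂m) ^ 2 ≤ (q.real univ - m.real univ) * ∫ x, f x ^ 2 ∂q := by
  have : IsFiniteMeasure m := isFiniteMeasure_of_le q hmq
  have hsub : q - m ≤ q := Measure.sub_le
  have hadd : q - m + m = q := Measure.sub_add_cancel_of_le hmq
  have integral_sub_measure : ∫ x, f x ∂q - ∫ x, f x ∂m = ∫ x, f x ∂(q - m) := by
    have hfi : Integrable f q := hf.integrable (by norm_num)
    rw [sub_eq_iff_eq_add, ← integral_add_measure (hfi.mono_measure hsub) (hfi.mono_measure hmq),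
      hadd]
  have measureReal_sub : q.real univ - m.real univ = (q - m).real univ := by
    rw [sub_eq_iff_eq_add, ← measureReal_add_apply, hadd]
  rw [integral_sub_measure, measureReal_sub]
  refine (sq_integral_le_measureReal_mul (hf.mono_measure hsub)).trans ?_
  exact mul_le_mul_of_nonneg_left
    (integral_mono_measure hsub (ae_of_all _ fun x => sq_nonneg _) hf.integrable_sq)
    measureReal_nonneg

variable {p : Kernel S S} [IsMarkovKernel p] [IsProbabilityMeasure ν] {hν : p.Invariant ν}

theorem mem_meanZero_iff {f : Lp ℝ 2 ν} : f ∈ meanZero ν ↔ ∫ x, f x ∂ν = 0 := Iff.rfl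

theorem norm_markovOperator_le_one : ‖markovOperator p ν hν‖ ≤ 1 :=
  LinearMap.mkContinuous_norm_le _ zero_le_one _

theorem markovOperator_const_one :
    markovOperator p ν hν (Lp.const 2 ν (1 : ℝ)) = Lp.const 2 ν (1 : ℝ) := by
  refine Lp.ext ?_
  filter_upwards [coeFn_markovOperator p ν hν (Lp.const 2 ν (1 : ℝ)),
    ae_ae_kernel p hν (Lp.coeFn_const 2 ν (1 : ℝ)), Lp.coeFn_const 2 ν (1 : ℝ)] with x h1 h2 h3
  rw [h1, integral_congr_ae h2, h3]
  simp

theorem mapsTo_markovOperator_meanZero :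
    MapsTo (markovOperator p ν hν) (meanZero ν) (meanZero ν) := fun f hf => by
  rw [SetLike.mem_coe, mem_meanZero_iff] at hf ⊢
  rw [integral_congr_ae (coeFn_markovOperator p ν hν f),
    integral_integral_of_invariant hν ((Lp.memLp f).integrable (by norm_num)), hf]

theorem mapsTo_adjoint_markovOperator_meanZero :
    MapsTo (ContinuousLinearMap.adjoint (markovOperator p ν hν)) (meanZero ν) (meanZero ν) :=
  fun f hf => by
    rw [SetLike.mem_coe, mem_meanZero_iff] at hf ⊢
    rw [← inner_const_one, ContinuousLinearMap.adjoint_inner_right, markovOperator_const_one,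
      inner_const_one, hf]

/-- The norm of `Pᵏ` as an operator `L²₀(ν) → L²₀(ν)`. Since `γ₂[(P*)ᵏ Pᵏ] = 1 - ‖Pᵏ‖²`, the
pseudo-spectral gap is a function of these coefficients. -/
noncomputable def contractionCoeff (p : Kernel S S) [IsMarkovKernel p] (ν : Measure S)
    [IsProbabilityMeasure ν] (hν : p.Invariant ν) (k : ℕ) : ℝ :=
  ‖(markovOperator p ν hν ^ k).comp (meanZero ν).subtypeL‖

theorem contractionCoeff_nonneg (k : ℕ) : 0 ≤ contractionCoeff p ν hν k :=
  norm_nonneg ((markovOperator p ν hν ^ k).comp (meanZero ν).subtypeL)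

theorem norm_markovOperator_pow_apply_le (k m : ℕ) {f : Lp ℝ 2 ν} (hf : f ∈ meanZero ν) :
    ‖(markovOperator p ν hν ^ m) f‖ ≤ contractionCoeff p ν hν k ^ (m / k) * ‖f‖ :=
  norm_pow_apply_le_pow_div norm_markovOperator_le_one mapsTo_markovOperator_meanZero k m hf

theorem contractionCoeff_le_one (k : ℕ) : contractionCoeff p ν hν k ≤ 1 :=
  ContinuousLinearMap.opNorm_le_bound _ zero_le_one fun ⟨f, hf⟩ => by
    simpa using norm_markovOperator_pow_apply_le (hν := hν) 0 k hf

theorem spectralGap_adjoint_pow_mul_pow (k : ℕ) :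
    spectralGap (ContinuousLinearMap.adjoint (markovOperator p ν hν) ^ k
      * markovOperator p ν hν ^ k) = 1 - contractionCoeff p ν hν k ^ 2 := by
  have adjoint_pow : ContinuousLinearMap.adjoint (markovOperator p ν hν) ^ k
      = ContinuousLinearMap.adjoint (markovOperator p ν hν ^ k) := by
    simp only [← ContinuousLinearMap.star_eq_adjoint, star_pow]
  have mapsTo_meanZero : MapsTo (ContinuousLinearMap.adjoint (markovOperator p ν hν) ^ k
      * markovOperator p ν hν ^ k) (meanZero ν) (meanZero ν) := by
    simp only [FunLike.coe_mul_eq_comp, FunLike.coe_pow_eq_iterate]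
    exact (mapsTo_adjoint_markovOperator_meanZero.iterate k).comp
      (mapsTo_markovOperator_meanZero.iterate k)
  rw [adjoint_pow] at mapsTo_meanZero ⊢
  rw [spectralGap, norm_adjoint_mul_self_comp_subtypeL _ mapsTo_meanZero, contractionCoeff]

theorem pseudoSpectralGap_eq_iSup :
    pseudoSpectralGap p ν hν = ⨆ k : ℕ+, (1 - contractionCoeff p ν hν k ^ 2) / (k : ℝ) :=
  iSup_congr fun k => by rw [spectralGap_adjoint_pow_mul_pow]

theorem one_sub_contractionCoeff_sq_div_le_pseudoSpectralGap (k : ℕ+) :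
    (1 - contractionCoeff p ν hν k ^ 2) / (k : ℝ) ≤ pseudoSpectralGap p ν hν := by
  rw [pseudoSpectralGap_eq_iSup]
  refine le_ciSup (f := fun k : ℕ+ => (1 - contractionCoeff p ν hν k ^ 2) / (k : ℝ)) ⟨1, ?_⟩ k
  rintro _ ⟨j, rfl⟩
  have one_le_cast : (1 : ℝ) ≤ (j : ℝ) := by exact_mod_cast j.pos
  exact div_le_one_of_le₀ (by linarith [sq_nonneg (contractionCoeff p ν hν j)]) (by positivity)

/-- Subtracting the constant `∫ f dm` from `P f` does not change its variance, while it replaces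
each `p x` by `p x - m`, whose mass is only `1 - m univ`. -/
theorem norm_sq_markovOperator_le_of_minorized {m : Measure S} (hm : ∀ᵐ x ∂ν, m ≤ p x)
    {f : Lp ℝ 2 ν} (hf : f ∈ meanZero ν) :
    ‖markovOperator p ν hν f‖ ^ 2 ≤ (1 - m.real univ) * ‖f‖ ^ 2 := by
  set g := markovOperator p ν hν f with hg
  have f_sq_integrable : Integrable (fun x => f x ^ 2) ν := (Lp.memLp f).integrable_sq
  have memLp_kernel : ∀ᵐ x ∂ν, MemLp f 2 (p x) := by
    filter_upwards [ae_integrable_kernel p hν f, Measure.ae_integrable_of_integrable_comp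
      (show Integrable (fun x => f x ^ 2) (p ∘ₘ ν) by rwa [hν.def])] with x h1 h2
    exact (memLp_two_iff_integrable_sq h1.1).2 h2
  have pointwise : ∀ᵐ x ∂ν,
      (g x - ∫ y, f y ∂m) ^ 2 ≤ (1 - m.real univ) * ∫ y, f y ^ 2 ∂(p x) := by
    filter_upwards [coeFn_markovOperator p ν hν f, memLp_kernel, hm] with x hgx hfx hmx
    rw [hg, hgx, ← probReal_univ (μ := p x)]
    exact sq_integral_sub_integral_le_of_le hmx hfx
  calc ‖g‖ ^ 2 = variance g ν := by
        rw [norm_sq_eq_integral_sq, variance_of_integral_eq_zero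
          (Lp.aestronglyMeasurable g).aemeasurable (mapsTo_markovOperator_meanZero hf)]
    _ = variance (fun x => g x - ∫ y, f y ∂m) ν :=
        (variance_sub_const (Lp.aestronglyMeasurable g) _).symm
    _ ≤ ∫ x, (g x - ∫ y, f y ∂m) ^ 2 ∂ν :=
        variance_le_expectation_sq ((Lp.aestronglyMeasurable g).sub aestronglyMeasurable_const)
    _ ≤ ∫ x, (1 - m.real univ) * ∫ y, f y ^ 2 ∂(p x) ∂ν :=
        integral_mono_ae ((Lp.memLp g).sub (memLp_const _)).integrable_sq
          ((integrable_integral_of_invariant hν f_sq_integrable).const_mul _) pointwise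
    _ = (1 - m.real univ) * ‖f‖ ^ 2 := by
        rw [integral_const_mul, integral_integral_of_invariant hν f_sq_integrable,
          norm_sq_eq_integral_sq]

theorem measureReal_univ_le_pseudoSpectralGap_of_minorized {m : Measure S}
    (hm : ∀ᵐ x ∂ν, m ≤ p x) : m.real univ ≤ pseudoSpectralGap p ν hν := by
  obtain ⟨x, hx⟩ := hm.exists
  have one_sub_nonneg : 0 ≤ 1 - m.real univ := by
    rw [sub_nonneg, ← probReal_univ (μ := p x)]
    exact ENNReal.toReal_mono (measure_ne_top _ _) (hx univ)
  have contractionCoeff_le : contractionCoeff p ν hν 1 ≤ √(1 - m.real univ) := by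
    refine ContinuousLinearMap.opNorm_le_bound _ (Real.sqrt_nonneg _) fun ⟨f, hf⟩ => ?_
    refine abs_le_of_sq_le_sq' ?_ (by positivity) |>.2
    rw [mul_pow, Real.sq_sqrt one_sub_nonneg]
    simpa using norm_sq_markovOperator_le_of_minorized (hν := hν) hm hf
  have := (Real.le_sqrt (contractionCoeff_nonneg 1) one_sub_nonneg).1 contractionCoeff_le
  calc m.real univ ≤ (1 - contractionCoeff p ν hν (1 : ℕ+) ^ 2) / ((1 : ℕ+) : ℝ) := by
        simpa using by linarith
    _ ≤ pseudoSpectralGap p ν hν := one_sub_contractionCoeff_sq_div_le_pseudoSpectralGap 1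

theorem pseudoSpectralGap_pos_of_minorized {m : Measure S} (hm0 : m ≠ 0)
    (hm : ∀ᵐ x ∂ν, m ≤ p x) : 0 < pseudoSpectralGap p ν hν := by
  obtain ⟨x, hx⟩ := hm.exists
  have : IsFiniteMeasure m := isFiniteMeasure_of_le (p x) hx
  have : NeZero m := ⟨hm0⟩
  exact measureReal_univ_pos.trans_le (measureReal_univ_le_pseudoSpectralGap_of_minorized hm)

end MarkovOperatorLemmas

/-! ### Second moments along the stationary chain -/

section Chain

variable {S : Type*} [MeasurableSpace S] {p : Kernel S S} [IsMarkovKernel p]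

section InitialLaw

variable {ν₀ : Measure S}

theorem map_eval_zero_chainLaw : (chainLaw p ν₀).map (fun θ => θ 0) = ν₀ := by
  have eval_eq : (fun θ : ℕ → S => θ 0) =
      (fun x : (i : Finset.Iic 0) → S => x ⟨0, Finset.mem_Iic.2 le_rfl⟩) ∘
        (Preorder.frestrictLe (π := fun _ => S) 0) := rfl
  rw [eval_eq, ← Measure.map_map (measurable_pi_apply _) (by fun_prop), chainLaw,
    Kernel.trajMeasure, Measure.map_comp _ _ (by fun_prop), Kernel.traj_map_frestrictLe,
    Kernel.partialTraj_self, Measure.id_comp, Measure.map_map (measurable_pi_apply _) (by fun_prop)]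
  exact Measure.map_id

theorem chainLaw_le_smul {ν : Measure S} {c : ℝ≥0∞} (h : ν₀ ≤ c • ν) :
    chainLaw p ν₀ ≤ c • chainLaw p ν := by
  rw [chainLaw, chainLaw, Kernel.trajMeasure, Kernel.trajMeasure, ← Measure.comp_smul,
    ← Measure.map_smul]
  refine Measure.le_iff.2 fun A hA => ?_
  rw [Measure.bind_apply hA (Kernel.aemeasurable _), Measure.bind_apply hA (Kernel.aemeasurable _)]
  exact lintegral_mono' (Measure.map_mono h (by fun_prop)) le_rfl

variable [IsProbabilityMeasure ν₀]

instance isProbabilityMeasure_chainLaw : IsProbabilityMeasure (chainLaw p ν₀) := by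
  unfold chainLaw
  infer_instance

theorem map_frestrictLe_chainLaw_compProd (n : ℕ) :
    (chainLaw p ν₀).map (Preorder.frestrictLe n) ⊗ₘ
        p.comap (fun x : (i : Finset.Iic n) → S => x ⟨n, Finset.mem_Iic.2 le_rfl⟩)
          (measurable_pi_apply _)
      = (chainLaw p ν₀).map fun θ => (Preorder.frestrictLe n θ, θ (n + 1)) :=
  Kernel.map_frestrictLe_trajMeasure_compProd_eq_map_trajMeasure (X := fun _ => S)

theorem map_eval_succ_chainLaw (n : ℕ) :
    (chainLaw p ν₀).map (fun θ => θ (n + 1)) = p ∘ₘ (chainLaw p ν₀).map (fun θ => θ n) := by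
  have last_measurable :
      Measurable fun x : (i : Finset.Iic n) → S => x ⟨n, Finset.mem_Iic.2 le_rfl⟩ :=
    measurable_pi_apply _
  calc (chainLaw p ν₀).map (fun θ => θ (n + 1))
      = ((chainLaw p ν₀).map fun θ => (Preorder.frestrictLe n θ, θ (n + 1))).snd := by
        rw [Measure.snd, Measure.map_map measurable_snd (by fun_prop)]
        rfl
    _ = p.comap _ last_measurable ∘ₘ (chainLaw p ν₀).map (Preorder.frestrictLe n) := by
        rw [← map_frestrictLe_chainLaw_compProd, Measure.snd_compProd]
    _ = p ∘ₘ (chainLaw p ν₀).map (fun θ => θ n) := by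
        rw [← Kernel.comp_deterministic_eq_comap, ← Measure.comp_assoc,
          Measure.deterministic_comp_eq_map, Measure.map_map last_measurable (by fun_prop)]
        rfl

theorem integral_chainLaw_succ {E : Type*} [NormedAddCommGroup E] [NormedSpace ℝ E] {n : ℕ}
    {G : ((i : Finset.Iic n) → S) × S → E} (hG : StronglyMeasurable G)
    (hint : Integrable (fun θ => G (Preorder.frestrictLe n θ, θ (n + 1))) (chainLaw p ν₀)) :
    ∫ θ, G (Preorder.frestrictLe n θ, θ (n + 1)) ∂(chainLaw p ν₀)
      = ∫ θ, ∫ y, G (Preorder.frestrictLe n θ, y) ∂(p (θ n)) ∂(chainLaw p ν₀) := by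
  have pair_measurable : Measurable fun θ : ℕ → S =>
      (Preorder.frestrictLe (π := fun _ => S) n θ, θ (n + 1)) := by fun_prop
  have G_integrable := (integrable_map_measure hG.aestronglyMeasurable
    pair_measurable.aemeasurable (μ := chainLaw p ν₀)).2 hint
  rw [← integral_map_of_stronglyMeasurable pair_measurable hG]
  rw [← map_frestrictLe_chainLaw_compProd] at G_integrable ⊢
  rw [Measure.integral_compProd G_integrable, integral_map_of_stronglyMeasurable (by fun_prop)
    hG.integral_kernel_prod_right']
  rfl

end InitialLaw

variable {ν : Measure S} [IsProbabilityMeasure ν] {hν : p.Invariant ν}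

theorem measurePreserving_eval_chainLaw (hν : p.Invariant ν) (n : ℕ) :
    MeasurePreserving (fun θ : ℕ → S => θ n) (chainLaw p ν) ν := by
  refine ⟨measurable_pi_apply n, ?_⟩
  induction n with
  | zero => exact map_eval_zero_chainLaw
  | succ n ih => rw [map_eval_succ_chainLaw, ih, hν.def]

theorem memLp_eval_chainLaw (hν : p.Invariant ν) {g : S → ℝ} (hg : MemLp g 2 ν) (n : ℕ) :
    MemLp (fun θ : ℕ → S => g (θ n)) 2 (chainLaw p ν) :=
  hg.comp_measurePreserving (measurePreserving_eval_chainLaw hν n)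

theorem integrable_eval_mul_eval_chainLaw (hν : p.Invariant ν) (g h : Lp ℝ 2 ν) (i j : ℕ) :
    Integrable (fun θ : ℕ → S => g (θ i) * h (θ j)) (chainLaw p ν) :=
  (memLp_eval_chainLaw hν (Lp.memLp g) i).integrable_mul (memLp_eval_chainLaw hν (Lp.memLp h) j)

theorem integral_eval_mul_eval_add_chainLaw (i m : ℕ) (g h : Lp ℝ 2 ν) :
    ∫ θ, g (θ i) * h (θ (i + m)) ∂(chainLaw p ν)
      = inner ℝ g ((markovOperator p ν hν ^ m) h) := by
  induction m generalizing h with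
  | zero =>
    have eval_preserving := measurePreserving_eval_chainLaw hν i
    calc ∫ θ, g (θ i) * h (θ i) ∂(chainLaw p ν) = ∫ x, g x * h x ∂ν := by
          have integral_map := integral_map_of_stronglyMeasurable (μ := chainLaw p ν)
            eval_preserving.measurable ((Lp.stronglyMeasurable g).mul (Lp.stronglyMeasurable h))
          rw [eval_preserving.map_eq] at integral_map
          exact integral_map.symm
      _ = inner ℝ g h := by simp [L2.inner_def, mul_comm]
  | succ m ih =>
    have markov_property : ∫ θ, g (θ i) * h (θ (i + m + 1)) ∂(chainLaw p ν)
        = ∫ θ, g (θ i) * ∫ y, h y ∂(p (θ (i + m))) ∂(chainLaw p ν) := by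
      simp only [← integral_const_mul]
      exact integral_chainLaw_succ
        (G := fun q => g (q.1 ⟨i, Finset.mem_Iic.2 (Nat.le_add_right i m)⟩) * h q.2)
        (((Lp.stronglyMeasurable g).comp_measurable (by fun_prop)).mul
          ((Lp.stronglyMeasurable h).comp_measurable measurable_snd))
        (integrable_eval_mul_eval_chainLaw hν g h i (i + m + 1))
    rw [pow_succ, mul_apply_eq_comp, ← ih, ← add_assoc, markov_property]
    refine integral_congr_ae ?_
    filter_upwards [(measurePreserving_eval_chainLaw hν (i + m)).quasiMeasurePreserving.ae
      (coeFn_markovOperator p ν hν h)] with θ hθ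
    rw [hθ]

theorem integral_eval_mul_eval_chainLaw (f : Lp ℝ 2 ν) (i j : ℕ) :
    ∫ θ, f (θ i) * f (θ j) ∂(chainLaw p ν)
      = inner ℝ f ((markovOperator p ν hν ^ Nat.dist i j) f) := by
  wlog hij : i ≤ j generalizing i j
  · rw [Nat.dist_comm, ← this j i (le_of_not_ge hij)]
    simp only [mul_comm]
  obtain ⟨m, rfl⟩ := Nat.exists_eq_add_of_le hij
  rw [integral_eval_mul_eval_add_chainLaw, Nat.dist_eq_sub_of_le hij, Nat.add_sub_cancel_left]

theorem integral_sq_sum_eval_chainLaw {ι : Type*} (s : Finset ι) (t : ι → ℕ) (f : Lp ℝ 2 ν) :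
    ∫ θ, (∑ a ∈ s, f (θ (t a))) ^ 2 ∂(chainLaw p ν)
      = ∑ a ∈ s, ∑ b ∈ s, inner ℝ f ((markovOperator p ν hν ^ Nat.dist (t a) (t b)) f) := by
  have products_integrable := integrable_eval_mul_eval_chainLaw hν f f
  simp only [sq, Finset.sum_mul_sum, ← integral_eval_mul_eval_chainLaw]
  rw [integral_finsetSum _ fun a _ => integrable_finsetSum _ fun b _ => products_integrable _ _]
  exact Finset.sum_congr rfl fun a _ => integral_finsetSum _ fun b _ => products_integrable _ _

theorem inner_markovOperator_pow_le (k m : ℕ) {f : Lp ℝ 2 ν} (hf : f ∈ meanZero ν) :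
    inner ℝ f ((markovOperator p ν hν ^ m) f) ≤ contractionCoeff p ν hν k ^ (m / k) * ‖f‖ ^ 2 :=
  calc inner ℝ f ((markovOperator p ν hν ^ m) f)
      ≤ ‖f‖ * ‖(markovOperator p ν hν ^ m) f‖ := real_inner_le_norm _ _
    _ ≤ ‖f‖ * (contractionCoeff p ν hν k ^ (m / k) * ‖f‖) := by
        gcongr
        exact norm_markovOperator_pow_apply_le k m hf
    _ = contractionCoeff p ν hν k ^ (m / k) * ‖f‖ ^ 2 := by ring

theorem integral_sq_sum_eval_chainLaw_le (k : ℕ) {f : Lp ℝ 2 ν} (hf : f ∈ meanZero ν)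
    (N nb : ℕ) :
    ∫ θ, (∑ n ∈ Finset.Icc 1 N, f (θ (n + nb))) ^ 2 ∂(chainLaw p ν)
      ≤ 2 * N * ‖f‖ ^ 2 * ∑ m ∈ Finset.range N, contractionCoeff p ν hν k ^ (m / k) := by
  rw [integral_sq_sum_eval_chainLaw (hν := hν)]
  have row_sum_le (i : ℕ) (hi : i ∈ Finset.Icc 1 N) :
      ∑ j ∈ Finset.Icc 1 N,
          inner ℝ f ((markovOperator p ν hν ^ Nat.dist (i + nb) (j + nb)) f)
        ≤ 2 * (∑ m ∈ Finset.range N, contractionCoeff p ν hν k ^ (m / k)) * ‖f‖ ^ 2 :=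
    calc _ ≤ ∑ j ∈ Finset.Icc 1 N,
          contractionCoeff p ν hν k ^ (Nat.dist i j / k) * ‖f‖ ^ 2 := by
          refine Finset.sum_le_sum fun j _ => ?_
          rw [Nat.dist_add_add_right]
          exact inner_markovOperator_pow_le k _ hf
      _ ≤ _ := by
          rw [← Finset.sum_mul]
          gcongr
          simpa only [nsmul_eq_mul, Nat.cast_ofNat] using
            sum_Icc_comp_dist_le (c := fun m => contractionCoeff p ν hν k ^ (m / k))
              (fun m => pow_nonneg (contractionCoeff_nonneg k) _) hi
  refine (Finset.sum_le_card_nsmul _ _ _ row_sum_le).trans_eq ?_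
  rw [Nat.card_Icc, Nat.add_sub_cancel, nsmul_eq_mul]
  ring

theorem pseudoSpectralGap_mul_integral_sq_sum_le {f : Lp ℝ 2 ν} (hf : f ∈ meanZero ν)
    (N nb : ℕ) :
    pseudoSpectralGap p ν hν * ∫ θ, (∑ n ∈ Finset.Icc 1 N, f (θ (n + nb))) ^ 2 ∂(chainLaw p ν)
      ≤ 4 * N * ‖f‖ ^ 2 := by
  rw [pseudoSpectralGap_eq_iSup, Real.iSup_mul_of_nonneg (integral_nonneg fun _ => sq_nonneg _)]
  refine ciSup_le fun k => ?_
  have gap_nonneg : 0 ≤ (1 - contractionCoeff p ν hν k ^ 2) / (k : ℝ) := div_nonneg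
    (sub_nonneg.2 (pow_le_one₀ (contractionCoeff_nonneg _) (contractionCoeff_le_one _)))
    (Nat.cast_nonneg _)
  calc _ ≤ (1 - contractionCoeff p ν hν k ^ 2) / (k : ℝ) * (2 * N * ‖f‖ ^ 2 *
        ∑ m ∈ Finset.range N, contractionCoeff p ν hν k ^ (m / (k : ℕ))) :=
        mul_le_mul_of_nonneg_left (integral_sq_sum_eval_chainLaw_le k hf N nb) gap_nonneg
    _ = 2 * N * ‖f‖ ^ 2 * ((1 - contractionCoeff p ν hν k ^ 2) / (k : ℝ) *
        ∑ m ∈ Finset.range N, contractionCoeff p ν hν k ^ (m / (k : ℕ))) := by ring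
    _ ≤ 2 * N * ‖f‖ ^ 2 * 2 := by
        gcongr
        exact one_sub_sq_div_mul_sum_pow_div_le_two k.pos (contractionCoeff_nonneg _)
          (contractionCoeff_le_one _) N
    _ = 4 * N * ‖f‖ ^ 2 := by ring

end Chain

/-! ### Mean square error -/

section MeanSquareError

variable {S : Type*} [MeasurableSpace S] {p : Kernel S S} [IsMarkovKernel p] {ν₀ ν : Measure S}
  {Y : S → ℝ} {N nb : ℕ}

theorem squaredError_eq (hN : 1 ≤ N) (θ : ℕ → S) :
    squaredError ν Y N nb θ =
      (∑ n ∈ Finset.Icc 1 N, (Y (θ (n + nb)) - ∫ x, Y x ∂ν)) ^ 2 / (N : ℝ) ^ 2 := by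
  rw [squaredError, ergodicEstimator, Finset.sum_sub_distrib, Finset.sum_const, Nat.card_Icc,
    Nat.add_sub_cancel, nsmul_eq_mul]
  field_simp

section Comparison

theorem initialDiscrepancy_nonneg : 0 ≤ initialDiscrepancy ν₀ ν :=
  ENNReal.toReal_nonneg

theorem le_ofReal_one_add_initialDiscrepancy_smul [SigmaFinite ν₀] [SigmaFinite ν] (hac : ν₀ ≪ ν)
    (hbdd : MemLp (initialDensity ν₀ ν) ∞ ν) :
    ν₀ ≤ ENNReal.ofReal (1 + initialDiscrepancy ν₀ ν) • ν := by
  have deviation_memLp : MemLp (fun x => initialDensity ν₀ ν x - 1) ∞ ν :=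
    hbdd.sub (memLp_top_const 1)
  have rnDeriv_le : ∀ᵐ x ∂ν, ν₀.rnDeriv ν x ≤ ENNReal.ofReal (1 + initialDiscrepancy ν₀ ν) := by
    filter_upwards [ae_le_eLpNormEssSup (f := fun x => initialDensity ν₀ ν x - 1) (μ := ν),
      ν₀.rnDeriv_lt_top ν] with x hx hlt
    rw [← eLpNorm_exponent_top] at hx
    have deviation_le : ‖initialDensity ν₀ ν x - 1‖ ≤ initialDiscrepancy ν₀ ν := by
      simpa only [toReal_enorm, initialDiscrepancy] using
        ENNReal.toReal_mono deviation_memLp.eLpNorm_ne_top hx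
    refine (ENNReal.le_ofReal_iff_toReal_le hlt.ne
      (add_nonneg zero_le_one initialDiscrepancy_nonneg)).2 ?_
    exact sub_le_iff_le_add'.1 ((Real.le_norm_self _).trans deviation_le)
  calc ν₀ = ν.withDensity (ν₀.rnDeriv ν) := (Measure.withDensity_rnDeriv_eq _ _ hac).symm
    _ ≤ ν.withDensity fun _ => ENNReal.ofReal (1 + initialDiscrepancy ν₀ ν) :=
      withDensity_mono rnDeriv_le
    _ = ENNReal.ofReal (1 + initialDiscrepancy ν₀ ν) • ν := withDensity_const _

theorem integrable_squaredError_of_le_smul {c : ℝ≥0∞} (hc : c ≠ ∞) (hle : ν₀ ≤ c • ν)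
    (hint : Integrable (squaredError ν Y N nb) (chainLaw p ν)) :
    Integrable (squaredError ν Y N nb) (chainLaw p ν₀) :=
  (hint.smul_measure hc).mono_measure (chainLaw_le_smul hle)

theorem meanSquareError_le_of_le_smul {c : ℝ≥0∞} (hc : c ≠ ∞) (hle : ν₀ ≤ c • ν)
    (hint : Integrable (squaredError ν Y N nb) (chainLaw p ν)) :
    meanSquareError p ν₀ ν Y N nb ≤ c.toReal * meanSquareError p ν ν Y N nb := by
  rw [meanSquareError, meanSquareError, ← smul_eq_mul, ← integral_smul_measure]
  exact integral_mono_measure (chainLaw_le_smul hle) (ae_of_all _ fun _ => sq_nonneg _)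
    (hint.smul_measure hc)

end Comparison

variable [IsProbabilityMeasure ν] {hν : p.Invariant ν}

theorem integrable_squaredError_chainLaw (hν : p.Invariant ν) (hY : MemLp Y 2 ν) (N nb : ℕ) :
    Integrable (squaredError ν Y N nb) (chainLaw p ν) := by
  have error_memLp :
      MemLp (fun θ => ergodicEstimator Y N nb θ - ∫ x, Y x ∂ν) 2 (chainLaw p ν) :=
    ((memLp_finsetSum _ fun n _ => memLp_eval_chainLaw hν hY (n + nb)).const_mul _).sub
      (memLp_const _)
  exact error_memLp.integrable_sq

theorem exists_mem_meanZero_ae_eq_sub_integral (hY : MemLp Y 2 ν) :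
    ∃ f ∈ meanZero ν, (f =ᵐ[ν] fun x => Y x - ∫ y, Y y ∂ν) ∧ ‖f‖ ^ 2 = variance Y ν := by
  have centered_memLp : MemLp (fun x => Y x - ∫ y, Y y ∂ν) 2 ν := hY.sub (memLp_const _)
  refine ⟨centered_memLp.toLp, ?_, centered_memLp.coeFn_toLp, ?_⟩
  · rw [mem_meanZero_iff, integral_congr_ae centered_memLp.coeFn_toLp,
      integral_sub (hY.integrable (by norm_num)) (integrable_const _)]
    simp
  · rw [norm_sq_eq_integral_sq, variance_eq_integral hY.1.aemeasurable]
    refine integral_congr_ae ?_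
    filter_upwards [centered_memLp.coeFn_toLp] with x hx
    rw [hx]

theorem pseudoSpectralGap_mul_meanSquareError_le (hY : MemLp Y 2 ν) (hN : 1 ≤ N) :
    pseudoSpectralGap p ν hν * meanSquareError p ν ν Y N nb ≤ 4 * (variance Y ν / N) := by
  obtain ⟨f, hf, f_ae_eq, norm_sq_f⟩ := exists_mem_meanZero_ae_eq_sub_integral hY
  have f_eval_eq : ∀ᵐ θ ∂(chainLaw p ν), ∀ n : ℕ, f (θ n) = Y (θ n) - ∫ x, Y x ∂ν :=
    ae_all_iff.2 fun n => (measurePreserving_eval_chainLaw hν n).quasiMeasurePreserving.ae f_ae_eq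
  have meanSquareError_eq : meanSquareError p ν ν Y N nb =
      (∫ θ, (∑ n ∈ Finset.Icc 1 N, f (θ (n + nb))) ^ 2 ∂(chainLaw p ν)) / (N : ℝ) ^ 2 := by
    rw [meanSquareError, ← integral_div]
    refine integral_congr_ae ?_
    filter_upwards [f_eval_eq] with θ hθ
    simp only [squaredError_eq hN, hθ]
  calc pseudoSpectralGap p ν hν * meanSquareError p ν ν Y N nb
      ≤ 4 * N * ‖f‖ ^ 2 / (N : ℝ) ^ 2 := by
        rw [meanSquareError_eq, ← mul_div_assoc]
        exact div_le_div_of_nonneg_right (pseudoSpectralGap_mul_integral_sq_sum_le hf N nb)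
          (sq_nonneg _)
    _ = 4 * (variance Y ν / N) := by
        rw [norm_sq_f]
        field_simp

theorem meanSquareError_le_constMse_mul [SigmaFinite ν₀] (hgap : 0 < pseudoSpectralGap p ν hν)
    (hac : ν₀ ≪ ν) (hbdd : MemLp (initialDensity ν₀ ν) ∞ ν) (hY : MemLp Y 2 ν) (hN : 1 ≤ N) :
    meanSquareError p ν₀ ν Y N nb ≤ constMse p ν₀ ν hν * (variance Y ν / N) := by
  have discrepancy_nonneg : 0 ≤ initialDiscrepancy ν₀ ν := initialDiscrepancy_nonneg
  have variance_div_nonneg : 0 ≤ variance Y ν / N :=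
    div_nonneg (variance_nonneg _ _) (Nat.cast_nonneg _)
  have stationary_le :
      meanSquareError p ν ν Y N nb ≤ 4 / pseudoSpectralGap p ν hν * (variance Y ν / N) := by
    rw [div_mul_eq_mul_div, le_div_iff₀' hgap]
    exact pseudoSpectralGap_mul_meanSquareError_le hY hN
  calc meanSquareError p ν₀ ν Y N nb
      ≤ (1 + initialDiscrepancy ν₀ ν) * meanSquareError p ν ν Y N nb := by
        have := meanSquareError_le_of_le_smul (p := p) ENNReal.ofReal_ne_top
          (le_ofReal_one_add_initialDiscrepancy_smul hac hbdd)
          (integrable_squaredError_chainLaw hν hY N nb)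
        rwa [ENNReal.toReal_ofReal (by positivity)] at this
    _ ≤ (1 + 2 * initialDiscrepancy ν₀ ν) *
          ((1 + 4 / pseudoSpectralGap p ν hν) * (variance Y ν / N)) := by
        have : 0 ≤ meanSquareError p ν ν Y N nb := integral_nonneg fun _ => sq_nonneg _
        gcongr
        · linarith
        · exact stationary_le.trans (by gcongr; linarith)
    _ = constMse p ν₀ ν hν * (variance Y ν / N) := by
        rw [constMse, constInv, constNs]
        ring

end MeanSquareError

/-! ### Minorization of the coupled chain -/

section Minorization

theorem exists_pos_forall_le_of_isCompact_sublevel {X : Type*} [TopologicalSpace X] {f : X → ℝ}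
    (hf : Continuous f) (hf0 : ∀ x, 0 < f x) (hc : ∀ r, 0 < r → IsCompact {x | f x ≤ r}) :
    ∃ c, 0 < c ∧ ∀ x, c ≤ f x := by
  rcases isEmpty_or_nonempty X with _ | ⟨⟨x₀⟩⟩
  · exact ⟨1, one_pos, isEmptyElim⟩
  · obtain ⟨x, hx⟩ := hf.exists_forall_le' x₀ <| by
      filter_upwards [(hc _ (hf0 x₀)).compl_mem_cocompact] with y hy
      exact le_of_not_ge fun h => hy h
    exact ⟨f x, hf0 x, hx⟩

theorem mul_le_acceptProb_mul {X : Type*} {π Q : X → ℝ} (hπ : ∀ z, 0 < π z) (hQ : ∀ z, 0 < Q z)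
    {c : ℝ} (hc : ∀ z, c ≤ Q z / π z) (θ z : X) : c * π z ≤ acceptProb π Q θ z * Q z := by
  have := (hQ z).ne'
  have := (hπ θ).ne'
  rw [acceptProb, min_mul_of_nonneg _ _ (hQ z).le, one_mul]
  refine le_min ((le_div_iff₀ (hπ z)).1 (hc z)) ?_
  calc c * π z ≤ Q θ / π θ * π z := mul_le_mul_of_nonneg_right (hc θ) (hπ z).le
    _ = Q θ * π z / (Q z * π θ) * Q z := by field_simp

namespace MultilevelModel

variable {X : Type*} [MeasurableSpace X] (M : MultilevelModel X)

/-- The Doeblin minorant `min {c₁ π_{ℓ-1}, c₂ π_ℓ} μ_pr` of the coupled chain, carried by the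
diagonal of `X × X` since it only accounts for the joint moves `(z, z)`. -/
noncomputable def minorant (i : Fin M.L) (c₁ c₂ : ℝ) : Measure (X × X) :=
  (M.prior.withDensity fun z =>
    ENNReal.ofReal (min (c₁ * M.post i.castSucc z) (c₂ * M.post i.succ z))).map fun z => (z, z)

variable {M} {i : Fin M.L} {c₁ c₂ : ℝ}

theorem minorant_ne_zero (hpost : ∀ j z, 0 < M.post j z) (h₁ : 0 < c₁) (h₂ : 0 < c₂) :
    M.minorant i c₁ c₂ ≠ 0 := by
  have coarse_measurable := M.post_measurable i.castSucc
  have fine_measurable := M.post_measurable i.succ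
  rw [minorant, Measure.map_ne_zero_iff (by fun_prop), Ne,
    withDensity_eq_zero_iff (by fun_prop)]
  intro density_ae_eq_zero
  obtain ⟨z, hz⟩ := density_ae_eq_zero.exists
  exact (ENNReal.ofReal_pos.2
    (lt_min (mul_pos h₁ (hpost _ z)) (mul_pos h₂ (hpost _ z)))).ne' hz

theorem minorant_le_jointKernel (hpost : ∀ j z, 0 < M.post j z) (hprop : ∀ z, 0 < M.prop i z)
    (h₁ : ∀ z, c₁ ≤ M.prop i z / M.post i.castSucc z)
    (h₂ : ∀ z, c₂ ≤ M.prop i z / M.post i.succ z) (θ : X × X) :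
    M.minorant i c₁ c₂ ≤ M.jointKernel i θ :=
  calc M.minorant i c₁ c₂
      ≤ (M.prior.withDensity fun z => ENNReal.ofReal (min (M.acceptCoarse i θ z)
          (M.acceptFine i θ z) * M.prop i z)).map fun z => (z, z) := by
        refine Measure.map_mono (withDensity_mono (ae_of_all _ fun z => ?_)) (by fun_prop)
        refine ENNReal.ofReal_le_ofReal ?_
        rw [min_mul_of_nonneg _ _ (hprop z).le]
        exact min_le_min (mul_le_acceptProb_mul (hpost _) hprop h₁ _ _)
          (mul_le_acceptProb_mul (hpost _) hprop h₂ _ _)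
    _ ≤ M.jointKernel i θ := by
        simp only [jointKernel, Kernel.coe_mk, add_assoc]
        exact Measure.le_add_right le_rfl

theorem Assumptions.exists_minorizing_measure [TopologicalSpace X] (hM : M.Assumptions)
    (i : Fin M.L) : ∃ m : Measure (X × X), m ≠ 0 ∧ ∀ θ, m ≤ M.jointKernel i θ := by
  have exists_lower_bound (j : Fin (M.L + 1))
      (hj : ∀ r : ℝ, 0 < r → IsCompact {z | M.prop i z / M.post j z ≤ r}) :
      ∃ c, 0 < c ∧ ∀ z, c ≤ M.prop i z / M.post j z :=
    exists_pos_forall_le_of_isCompact_sublevel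
      ((hM.prop_continuous i).div (hM.post_continuous j) fun z => (hM.post_pos j z).ne')
      (fun z => div_pos (hM.prop_pos i z) (hM.post_pos j z)) hj
  obtain ⟨c₁, hc₁, h₁⟩ := exists_lower_bound _ (hM.compact_coarse i)
  obtain ⟨c₂, hc₂, h₂⟩ := exists_lower_bound _ (hM.compact_fine i)
  exact ⟨M.minorant i c₁ c₂, minorant_ne_zero hM.post_pos hc₁ hc₂,
    minorant_le_jointKernel hM.post_pos (hM.prop_pos i) h₁ h₂⟩

end MultilevelModel

end Minorization

theorem mainTheorem2_general {S : Type*} [MeasurableSpace S] (p : Kernel S S) [IsMarkovKernel p]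
    (ν : Measure S) [IsProbabilityMeasure ν] (hν : p.Invariant ν)
    (hp : ∃ m : Measure S, m ≠ 0 ∧ ∀ᵐ x ∂ν, m ≤ p x)
    (ν₀ : Measure S) [IsProbabilityMeasure ν₀] (hac : ν₀ ≪ ν)
    (hbdd : MemLp (initialDensity ν₀ ν) ∞ ν)
    (Y : S → ℝ) (hY : MemLp Y 2 ν) (N nb : ℕ) (hN : 1 ≤ N) :
    0 < pseudoSpectralGap p ν hν ∧
    Integrable (squaredError ν Y N nb) (chainLaw p ν₀) ∧
    meanSquareError p ν₀ ν Y N nb ≤ constMse p ν₀ ν hν * (variance Y ν / N) := by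
  obtain ⟨m, hm0, hm⟩ := hp
  have gap_pos : 0 < pseudoSpectralGap p ν hν := pseudoSpectralGap_pos_of_minorized hm0 hm
  have stationary_integrable := integrable_squaredError_chainLaw hν hY N nb
  have initial_le := le_ofReal_one_add_initialDiscrepancy_smul hac hbdd
  exact ⟨gap_pos,
    integrable_squaredError_of_le_smul ENNReal.ofReal_ne_top initial_le stationary_integrable,
    meanSquareError_le_constMse_mul gap_pos hac hbdd hY hN⟩

theorem mainTheorem2 {X : Type*} [TopologicalSpace X] [PolishSpace X] [MeasurableSpace X]
    [BorelSpace X] (M : MultilevelModel X) (hM : M.Assumptions) (i : Fin M.L)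
    (ν : Measure (X × X)) [IsProbabilityMeasure ν] (hν : (M.jointKernel i).Invariant ν)
    (ν₀ : Measure (X × X)) [IsProbabilityMeasure ν₀] (hac : ν₀ ≪ ν)
    (hbdd : MemLp (initialDensity ν₀ ν) ∞ ν)
    (Y : X × X → ℝ) (hY : MemLp Y 2 ν) (N nb : ℕ) (hN : 1 ≤ N) :
    0 < pseudoSpectralGap (M.jointKernel i) ν hν ∧
    Integrable (squaredError ν Y N nb) (chainLaw (M.jointKernel i) ν₀) ∧
    meanSquareError (M.jointKernel i) ν₀ ν Y N nb
      ≤ constMse (M.jointKernel i) ν₀ ν hν * (variance Y ν / N) := by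
  obtain ⟨m, hm0, hm⟩ := hM.exists_minorizing_measure i
  exact mainTheorem2_general _ ν hν ⟨m, hm0, ae_of_all _ hm⟩ ν₀ hac hbdd Y hY N nb hN
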